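/- A Perron number of degree $n\ge 2$ is a real algebraic integer $\alpha$ of degree $n$ with conjugates $\alpha_1=\alpha,\alpha_2,\dots,\alpha_n$ such that $\alpha>|\alpha_i|$ for $i=2,\dots,n$. For every $n>2$ there is a smallest Perron number of degree $n$. Assume the Lind–Boyd conjecture: for every $n>2$, the smallest Perron number of degree $n$ has minimal polynomial \[ \begin{cases} x^n-x-1 & \text{if } n\not\equiv 3,5 \pmod 6,\\ (x^{n+2}-x^4-1)/(x^2-x+1) & \text{if } n\equiv 3 \pmod 6,\\ (x^{n+2}-x^2-1)/(x^2-x+1) & \text{if } n\equiv 5 \pmod 6. \end{cases} \] For $n>2$ let $\nu_n$ be the number of conjugates $\alpha_i$ of the smallest Perron number of degree $n$ with $|\alpha_i|>1$. Then $\nu_n\sim\frac23 n$ as $n\to\infty$. -/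

import Mathlib

open Polynomial Filter Asymptotics

/-- The complex conjugates of a real number `α`: the complex roots of its minimal polynomial
over `ℚ` (for `α` algebraic of degree `n` there are exactly `n` of them, as the minimal
polynomial is separable). -/
noncomputable def conjugates (α : ℝ) : Set ℂ :=
  (minpoly ℚ α).rootSet ℂ

/-- A Perron number of degree `n`: a real algebraic integer of degree `n ≥ 2` which is strictly
larger than the modulus of each of its other conjugates. -/
structure IsPerron (n : ℕ) (α : ℝ) : Prop where
  isIntegral : IsIntegral ℤ α
  degree_eq : (minpoly ℚ α).natDegree = n
  two_le : 2 ≤ n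
  dominant : ∀ z ∈ conjugates α, z ≠ (α : ℂ) → ‖z‖ < α

/-- `α` is the smallest Perron number of degree `n`. -/
def IsSmallestPerron (n : ℕ) (α : ℝ) : Prop :=
  IsLeast {β : ℝ | IsPerron n β} α

/-- The number of conjugates of `α` of modulus greater than `1`. -/
noncomputable def nu (α : ℝ) : ℕ :=
  {z ∈ conjugates α | 1 < ‖z‖}.ncard

/-- The Lind–Boyd conjecture on the minimal polynomials of the smallest Perron numbers. The
quotients by `X ^ 2 - X + 1` are written as products. -/
def LindBoydConjecture : Prop :=
  ∀ (n : ℕ) (α : ℝ), 2 < n → IsSmallestPerron n α →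
    (n % 6 ≠ 3 → n % 6 ≠ 5 → minpoly ℚ α = X ^ n - X - 1) ∧
    (n % 6 = 3 → minpoly ℚ α * (X ^ 2 - X + 1) = X ^ (n + 2) - X ^ 4 - 1) ∧
    (n % 6 = 5 → minpoly ℚ α * (X ^ 2 - X + 1) = X ^ (n + 2) - X ^ 2 - 1)

/-! Under the conjecture, up to a factor `X ^ 2 - X + 1` whose roots lie on the unit circle, the
minimal polynomial is a trinomial `X ^ N - X ^ k - 1` with k = 1, 2 or 4 and N = n or n + 2. A root
satisfies z^N = 1 + z^k, so |z| > 1 iff |1 + z^k| > 1. The roots approach the unit circle uniformly,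
so in the limit this says cos arg(z^k) > -1/2, i.e. |arg(z^k)| < 2π/3. The coefficients strictly
between k and N vanish, so by Newton's identities ∑ z^(km) = 0 once N > km + k. By Weyl's criterion
the angles arg(z^k) equidistribute, and the arc has density 2/3. Smallest Perron numbers exist
because `X ^ n - X - 1` yields one Perron number and only finitely many lie below it. -/

section Equidistribution

/-! ### Weyl equidistribution and densities of arcs. -/

open Topology MeasureTheory AddCircle

/-- **Weyl's criterion** on the circle: if all nontrivial exponential averages of a triangular
array of points tend to zero, then the averages of every continuous function tend to its mean. -/
theorem tendsto_average_of_tendsto_average_fourier {T : ℝ} [hT : Fact (0 < T)]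
    {x : (N : ℕ) → Fin N → AddCircle T}
    (h : ∀ m : ℕ, 0 < m →
      Tendsto (fun N : ℕ => (N : ℂ)⁻¹ * ∑ i, fourier (m : ℤ) (x N i)) atTop (𝓝 0))
    (φ : C(AddCircle T, ℂ)) :
    Tendsto (fun N : ℕ => (N : ℂ)⁻¹ * ∑ i, φ (x N i)) atTop (𝓝 (fourierCoeff φ 0)) := by
  have hint : ∀ φ : C(AddCircle T, ℂ), Integrable φ haarAddCircle := fun φ =>
    φ.continuous.integrable_of_hasCompactSupport (HasCompactSupport.of_compactSpace _)
  have hcoef : ∀ φ : C(AddCircle T, ℂ), fourierCoeff φ 0 = ∫ t, φ t ∂haarAddCircle := by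
    intro φ
    simp [fourierCoeff]
  -- The functions satisfying the claim form a subspace. It contains the characters, whose span is
  -- uniformly dense; an ε/3 argument then reaches every `φ`.
  let S : Submodule ℂ C(AddCircle T, ℂ) :=
    { carrier := {φ | Tendsto (fun N : ℕ => (N : ℂ)⁻¹ * ∑ i, φ (x N i)) atTop
        (𝓝 (fourierCoeff φ 0))}
      add_mem' := by
        intro f g hf hg
        have := Tendsto.add hf hg
        simp only [hcoef, Set.mem_ofPred_eq, ContinuousMap.add_apply, Finset.sum_add_distrib,
          mul_add] at this ⊢
        rwa [integral_add (hint f) (hint g)]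
      zero_mem' := by simp [hcoef]
      smul_mem' := by
        intro c f hf
        have := Tendsto.const_mul c hf
        simp only [hcoef, Set.mem_ofPred_eq, ContinuousMap.smul_apply, smul_eq_mul,
          ← Finset.mul_sum, integral_const_mul] at this ⊢
        refine this.congr fun N => by ring }
  have hfour : Submodule.span ℂ (Set.range (@fourier T)) ≤ S := by
    rw [Submodule.span_le]
    rintro _ ⟨n, rfl⟩
    change Tendsto _ _ _
    rw [fourierCoeff_fourier]
    obtain ⟨m, rfl | rfl⟩ := n.eq_nat_or_neg
    · rcases Nat.eq_zero_or_pos m with rfl | hm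
      · refine tendsto_const_nhds.congr' ?_
        filter_upwards [eventually_gt_atTop 0] with N hN
        have : (N : ℂ) ≠ 0 := by exact_mod_cast hN.ne'
        simp [this]
      · rw [Pi.single_eq_of_ne (by omega)]
        exact h m hm
    · rcases Nat.eq_zero_or_pos m with rfl | hm
      · refine tendsto_const_nhds.congr' ?_
        filter_upwards [eventually_gt_atTop 0] with N hN
        have : (N : ℂ) ≠ 0 := by exact_mod_cast hN.ne'
        simp [this]
      · rw [Pi.single_eq_of_ne (by omega)]
        -- Negative frequencies follow by complex conjugation.
        have := (Complex.continuous_conj.tendsto 0).comp (h m hm)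
        rw [map_zero] at this
        refine this.congr fun N => ?_
        simp only [Function.comp, map_mul, map_inv₀, map_sum, Complex.conj_natCast, fourier_neg]
  have hmem : φ ∈ (Submodule.span ℂ (Set.range (@fourier T))).topologicalClosure := by
    rw [span_fourier_closure_eq_top]; trivial
  rw [Metric.tendsto_atTop]
  intro ε hε
  obtain ⟨ψ, hψ, hd⟩ := Metric.mem_closure_iff.1 hmem (ε / 3) (by positivity)
  have hψ' := hfour hψ
  change Tendsto _ _ _ at hψ'
  obtain ⟨N₀, hN₀⟩ := Metric.tendsto_atTop.1 hψ' (ε / 3) (by positivity)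
  have hpt : ∀ t, ‖φ t - ψ t‖ ≤ ε / 3 := fun t => by
    rw [← dist_eq_norm]; exact (ContinuousMap.dist_apply_le_dist t).trans hd.le
  refine ⟨N₀ + 1, fun N hN => ?_⟩
  have hNpos : (0 : ℝ) < N := by exact_mod_cast (by omega : 0 < N)
  have h1 : ‖(N : ℂ)⁻¹ * ∑ i, φ (x N i) - (N : ℂ)⁻¹ * ∑ i, ψ (x N i)‖ ≤ ε / 3 := by
    rw [← mul_sub, ← Finset.sum_sub_distrib, norm_mul, norm_inv, Complex.norm_natCast,
      inv_mul_le_iff₀ hNpos]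
    refine (norm_sum_le _ _).trans ((Finset.sum_le_sum fun i _ => hpt _).trans ?_)
    simp
  have h2 : ‖fourierCoeff φ 0 - fourierCoeff ψ 0‖ ≤ ε / 3 := by
    rw [hcoef, hcoef, ← integral_sub (hint φ) (hint ψ)]
    simpa using norm_integral_le_of_norm_le_const (μ := haarAddCircle)
      (Eventually.of_forall hpt)
  have h3 := hN₀ N (by omega)
  rw [dist_eq_norm] at h3 ⊢
  calc _ = ‖((N : ℂ)⁻¹ * ∑ i, φ (x N i) - (N : ℂ)⁻¹ * ∑ i, ψ (x N i)) +
        ((N : ℂ)⁻¹ * ∑ i, ψ (x N i) - fourierCoeff ψ 0) -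
        (fourierCoeff φ 0 - fourierCoeff ψ 0)‖ := by congr 1; ring
    _ < ε / 3 + ε / 3 + ε / 3 := lt_of_le_of_lt (norm_sub_le _ _)
        (add_lt_add_of_lt_of_le (lt_of_le_of_lt (norm_add_le _ _)
          (add_lt_add_of_le_of_lt h1 h3)) h2)
    _ = ε := by ring

/-- A clamped affine function of `cos`, interpolating between the indicator functions of two
arcs. -/
noncomputable def cosRamp (a b : ℝ) (t : ℝ) : ℝ :=
  max 0 (min 1 ((Real.cos t - Real.cos b) / (Real.cos a - Real.cos b)))

theorem cosRamp_nonneg (a b t : ℝ) : 0 ≤ cosRamp a b t := le_max_left _ _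

theorem cosRamp_le_one (a b t : ℝ) : cosRamp a b t ≤ 1 :=
  max_le zero_le_one (min_le_left _ _)

theorem continuous_cosRamp (a b : ℝ) : Continuous (cosRamp a b) := by
  unfold cosRamp; fun_prop

theorem periodic_cosRamp (a b : ℝ) : Function.Periodic (cosRamp a b) (2 * Real.pi) := fun t => by
  simp [cosRamp]

theorem cosRamp_eq_one {a b t : ℝ} (hab : Real.cos b < Real.cos a)
    (h : Real.cos a ≤ Real.cos t) : cosRamp a b t = 1 := by
  have : 1 ≤ (Real.cos t - Real.cos b) / (Real.cos a - Real.cos b) := by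
    rw [le_div_iff₀ (by linarith)]; linarith
  simp [cosRamp, this]

theorem cosRamp_eq_zero {a b t : ℝ} (hab : Real.cos b < Real.cos a)
    (h : Real.cos t ≤ Real.cos b) : cosRamp a b t = 0 := by
  have : (Real.cos t - Real.cos b) / (Real.cos a - Real.cos b) ≤ 0 :=
    div_nonpos_of_nonpos_of_nonneg (by linarith) (by linarith)
  exact max_eq_left ((min_le_right _ _).trans this)

theorem cosRamp_neg (a b t : ℝ) : cosRamp a b (-t) = cosRamp a b t := by
  simp [cosRamp]

theorem integral_cosRamp_eq (a b : ℝ) :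
    ∫ t in (-Real.pi)..Real.pi, cosRamp a b t = 2 * ∫ t in (0 : ℝ)..Real.pi, cosRamp a b t := by
  have hi := fun u v => (continuous_cosRamp a b).intervalIntegrable u v (μ := volume)
  rw [← intervalIntegral.integral_add_adjacent_intervals (hi _ 0) (hi 0 _), two_mul]
  congr 1
  have := intervalIntegral.integral_comp_neg (a := 0) (b := Real.pi) (cosRamp a b)
  simpa [cosRamp_neg] using this.symm

/-- On [-π, π] the ramp lies between the indicators of |t| ≤ a and |t| ≤ b. This bound and the next
pin its mean between a/π and b/π. -/
theorem integral_cosRamp_le {a b : ℝ} (ha : 0 ≤ a) (hab : a < b) (hb : b ≤ Real.pi) :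
    ∫ t in (-Real.pi)..Real.pi, cosRamp a b t ≤ 2 * b := by
  have hi := fun u v => (continuous_cosRamp a b).intervalIntegrable u v (μ := volume)
  have hcos := Real.cos_lt_cos_of_nonneg_of_le_pi ha hb hab
  rw [integral_cosRamp_eq, ← intervalIntegral.integral_add_adjacent_intervals (hi 0 b) (hi b _)]
  have h1 : ∫ t in (0 : ℝ)..b, cosRamp a b t ≤ ∫ t in (0 : ℝ)..b, (1 : ℝ) :=
    intervalIntegral.integral_mono_on (by linarith) (hi _ _) (by simp)
      fun t _ => cosRamp_le_one a b t
  have h2 : ∫ t in b..Real.pi, cosRamp a b t = ∫ t in b..Real.pi, (0 : ℝ) := by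
    refine intervalIntegral.integral_congr fun t ht => ?_
    rw [Set.uIcc_of_le hb] at ht
    exact cosRamp_eq_zero hcos (Real.cos_le_cos_of_nonneg_of_le_pi (by linarith) ht.2 ht.1)
  simp only [intervalIntegral.integral_const, smul_eq_mul, mul_one, mul_zero, sub_zero] at h1 h2
  linarith

theorem le_integral_cosRamp {a b : ℝ} (ha : 0 ≤ a) (hab : a < b) (hb : b ≤ Real.pi) :
    2 * a ≤ ∫ t in (-Real.pi)..Real.pi, cosRamp a b t := by
  have hi := fun u v => (continuous_cosRamp a b).intervalIntegrable u v (μ := volume)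
  have hcos := Real.cos_lt_cos_of_nonneg_of_le_pi ha hb hab
  rw [integral_cosRamp_eq, ← intervalIntegral.integral_add_adjacent_intervals (hi 0 a) (hi a _)]
  have h1 : ∫ t in (0 : ℝ)..a, cosRamp a b t = ∫ t in (0 : ℝ)..a, (1 : ℝ) := by
    refine intervalIntegral.integral_congr fun t ht => ?_
    rw [Set.uIcc_of_le ha] at ht
    exact cosRamp_eq_one hcos (Real.cos_le_cos_of_nonneg_of_le_pi ht.1 (by linarith) ht.2)
  have h2 : 0 ≤ ∫ t in a..Real.pi, cosRamp a b t :=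
    intervalIntegral.integral_nonneg (by linarith) fun t _ => cosRamp_nonneg a b t
  simp only [intervalIntegral.integral_const, smul_eq_mul, mul_one, sub_zero] at h1
  linarith

/-- Averages of `cosRamp` along an equidistributed array of angles. -/
theorem tendsto_average_cosRamp {θ : (N : ℕ) → Fin N → ℝ}
    (h : ∀ m : ℕ, 0 < m →
      Tendsto (fun N : ℕ => (N : ℂ)⁻¹ * ∑ i, Complex.exp (m * θ N i * Complex.I)) atTop (𝓝 0))
    (a b : ℝ) :
    Tendsto (fun N : ℕ => (N : ℝ)⁻¹ * ∑ i, cosRamp a b (θ N i)) atTop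
      (𝓝 ((2 * Real.pi)⁻¹ * ∫ t in (-Real.pi)..Real.pi, cosRamp a b t)) := by
  have : Fact (0 < 2 * Real.pi) := ⟨Real.two_pi_pos⟩
  let φ : C(AddCircle (2 * Real.pi), ℂ) :=
    { toFun := fun x => ((periodic_cosRamp a b).lift x : ℂ)
      continuous_toFun := Complex.continuous_ofReal.comp
        (continuous_coinduced_dom.2 (continuous_cosRamp a b)) }
  have hφ : ∀ t : ℝ, φ (t : AddCircle (2 * Real.pi)) = (cosRamp a b t : ℂ) := fun t => rfl
  have key := tendsto_average_of_tendsto_average_fourier (T := 2 * Real.pi)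
    (x := fun N i => (θ N i : AddCircle (2 * Real.pi))) ?_ φ
  · rw [fourierCoeff_eq_intervalIntegral _ _ (-Real.pi)] at key
    have h2 : -Real.pi + 2 * Real.pi = Real.pi := by ring
    simp only [hφ, neg_zero, fourier_zero, one_smul, h2, intervalIntegral.integral_ofReal] at key
    have := (Complex.continuous_re.tendsto _).comp key
    refine (this.congr fun N => ?_).trans (le_of_eq ?_)
    · simp only [Function.comp]
      rw [← Complex.ofReal_sum, ← Complex.ofReal_natCast, ← Complex.ofReal_inv,
        ← Complex.ofReal_mul, Complex.ofReal_re]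
    · simp
  · intro m hm
    refine (h m hm).congr fun N => ?_
    congr 1
    refine Finset.sum_congr rfl fun i _ => ?_
    rw [fourier_coe_apply]
    congr 1
    have : (Real.pi : ℂ) ≠ 0 := by exact_mod_cast Real.pi_ne_zero
    push_cast
    field_simp

/-- For an equidistributed array of angles, a sequence of index sets squeezed between arcs
shrinking to `|θ| < β` has density `β / π`. -/
theorem tendsto_density_of_equidistributed {θ : (N : ℕ) → Fin N → ℝ}
    (h : ∀ m : ℕ, 0 < m →
      Tendsto (fun N : ℕ => (N : ℂ)⁻¹ * ∑ i, Complex.exp (m * θ N i * Complex.I)) atTop (𝓝 0))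
    {β : ℝ} (hβ : 0 < β) (hβ' : β < Real.pi) {A : (N : ℕ) → Finset (Fin N)}
    (hlow : ∀ a, 0 ≤ a → a < β → ∀ᶠ N in atTop, ∀ i, Real.cos a < Real.cos (θ N i) → i ∈ A N)
    (hupp : ∀ b, β < b → b ≤ Real.pi → ∀ᶠ N in atTop, ∀ i ∈ A N, Real.cos b ≤ Real.cos (θ N i)) :
    Tendsto (fun N : ℕ => ((A N).card : ℝ) / N) atTop (𝓝 (β / Real.pi)) := by
  have hpi := Real.pi_pos
  rw [tendsto_order]
  constructor
  · intro c hc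
    -- With cπ < a₀ the ramp has mean at least a₀/π > c, and b < β keeps its support within the arc
    -- that `hlow` puts in `A N`.
    obtain ⟨a₀, ha₀, haβ⟩ : ∃ a, max 0 (c * Real.pi) < a ∧ a < β := by
      apply exists_between
      rw [lt_div_iff₀ hpi] at hc
      exact max_lt hβ hc
    obtain ⟨b, hb₀, hb⟩ := exists_between haβ
    have ha0 : 0 ≤ a₀ := (le_max_left _ _).trans ha₀.le
    have hcos := Real.cos_lt_cos_of_nonneg_of_le_pi ha0 (by linarith) hb₀
    have hlim := tendsto_average_cosRamp h a₀ b
    have hI := le_integral_cosRamp ha0 hb₀ (by linarith)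
    have : c < (2 * Real.pi)⁻¹ * ∫ t in (-Real.pi)..Real.pi, cosRamp a₀ b t := by
      rw [← div_eq_inv_mul, lt_div_iff₀ (by positivity)]
      have := (le_max_right 0 (c * Real.pi)).trans_lt ha₀
      linarith
    filter_upwards [hlim.eventually_const_lt this, hlow b (by linarith) hb,
      eventually_gt_atTop 0] with N h1 h2 hN
    have hNpos : (0 : ℝ) < N := by exact_mod_cast hN
    refine h1.trans_le ?_
    rw [← div_eq_inv_mul]
    gcongr
    rw [← nsmul_one, ← Finset.sum_const, ← Finset.sum_subset (Finset.subset_univ (A N))]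
    · exact Finset.sum_le_sum fun i _ => cosRamp_le_one _ _ _
    · intro i _ hi
      exact cosRamp_eq_zero hcos (not_lt.1 fun hlt => hi (h2 i hlt))
  · intro c hc
    obtain ⟨b, hβb, hb₀⟩ : ∃ b, β < b ∧ b < min Real.pi (c * Real.pi) := by
      apply exists_between
      rw [gt_iff_lt, div_lt_iff₀ hpi] at hc
      exact lt_min hβ' hc
    obtain ⟨a, ha, hab⟩ := exists_between hβb
    have hbpi : b ≤ Real.pi := hb₀.le.trans (min_le_left _ _)
    have hcos := Real.cos_lt_cos_of_nonneg_of_le_pi (by linarith) hbpi hab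
    have hlim := tendsto_average_cosRamp h a b
    have hI := integral_cosRamp_le (by linarith) hab hbpi
    have : (2 * Real.pi)⁻¹ * ∫ t in (-Real.pi)..Real.pi, cosRamp a b t < c := by
      rw [← div_eq_inv_mul, div_lt_iff₀ (by positivity)]
      have := hb₀.trans_le (min_le_right _ _)
      linarith
    filter_upwards [hlim.eventually_lt_const this, hupp a ha (by linarith),
      eventually_gt_atTop 0] with N h1 h2 hN
    have hNpos : (0 : ℝ) < N := by exact_mod_cast hN
    refine lt_of_le_of_lt ?_ h1
    rw [← div_eq_inv_mul]
    gcongr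
    rw [← nsmul_one, ← Finset.sum_const]
    refine (Finset.sum_le_sum fun i hi => (cosRamp_eq_one hcos (h2 i hi)).ge).trans ?_
    exact Finset.sum_le_sum_of_subset_of_nonneg (Finset.subset_univ _)
      fun i _ _ => cosRamp_nonneg _ _ _

end Equidistribution
-- Roots of `X ^ N - X ^ k - 1`.
section Trinomial

open Topology

/-- Power sums vanish below the first nonvanishing elementary symmetric function. -/
theorem sum_pow_eq_zero_of_esymm_eq_zero {N : ℕ} (z : Fin N → ℂ) {m : ℕ} (hm : 0 < m)
    (h : ∀ j, 0 < j → j ≤ m → (Finset.univ.val.map z).esymm j = 0) : ∑ i, z i ^ m = 0 := by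
  have hN := congrArg (MvPolynomial.aeval z) (MvPolynomial.psum_eq_mul_esymm_sub_sum (Fin N) ℂ m hm)
  simp only [map_sub, map_mul, map_sum, MvPolynomial.aeval_esymm_eq_multiset_esymm,
    h m hm le_rfl, mul_zero, zero_sub] at hN
  rw [Finset.sum_eq_zero] at hN
  · simpa [MvPolynomial.psum] using hN
  · intro a ha
    obtain ⟨_, h0, h1⟩ := Finset.mem_filter.1 ha
    rw [h a.1 h0 h1.le, mul_zero, zero_mul]

/-- The trinomial `X ^ N - X ^ k - 1` over a commutative ring. -/
noncomputable def trinomialPerron (R : Type*) [CommRing R] (N k : ℕ) : R[X] := X ^ N - X ^ k - 1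

theorem natDegree_trinomialPerron {R : Type*} [CommRing R] [Nontrivial R] {N k : ℕ} (h : k < N) :
    (trinomialPerron R N k).natDegree = N := by
  unfold trinomialPerron
  have hN : N ≠ 0 := by omega
  compute_degree
  · simp [h.ne', hN]
  all_goals omega

theorem monic_trinomialPerron {R : Type*} [CommRing R] [Nontrivial R] {N k : ℕ} (h : k < N) :
    (trinomialPerron R N k).Monic := by
  have hN : N ≠ 0 := by omega
  rw [Monic, leadingCoeff, natDegree_trinomialPerron h]
  simp [trinomialPerron, coeff_X_pow, coeff_one, h.ne', hN]

theorem coeff_trinomialPerron {R : Type*} [CommRing R] {N k j : ℕ} (hk : k < j) (hN : j < N) :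
    (trinomialPerron R N k).coeff j = 0 := by
  have hj : j ≠ 0 := by omega
  simp [trinomialPerron, coeff_X_pow, coeff_one, hk.ne', hN.ne, hj]

theorem trinomialPerron_ne_zero {N k : ℕ} (h : k < N) : trinomialPerron ℂ N k ≠ 0 :=
  ne_zero_of_natDegree_gt (n := k) (by rwa [natDegree_trinomialPerron h])

theorem card_roots_trinomialPerron {N k : ℕ} (h : k < N) :
    (trinomialPerron ℂ N k).roots.card = N := by
  rw [IsAlgClosed.card_roots_eq_natDegree, natDegree_trinomialPerron h]

theorem pow_eq_of_mem_roots_trinomialPerron {N k : ℕ} {z : ℂ}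
    (hz : z ∈ (trinomialPerron ℂ N k).roots) : z ^ N = 1 + z ^ k := by
  have := (mem_roots'.1 hz).2
  simp only [trinomialPerron, IsRoot.def, eval_sub, eval_pow, eval_X, eval_one] at this
  linear_combination this

theorem sum_pow_roots_trinomialPerron {N k m : ℕ} (hm : 0 < m) (hN : m + k < N) (z : Fin N → ℂ)
    (hz : Finset.univ.val.map z = (trinomialPerron ℂ N k).roots) : ∑ i, z i ^ m = 0 := by
  refine sum_pow_eq_zero_of_esymm_eq_zero z hm fun j hj hjm => ?_
  have hk : k < N := by omega
  have hdeg := natDegree_trinomialPerron (R := ℂ) hk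
  have := coeff_eq_esymm_roots_of_card (p := trinomialPerron ℂ N k)
    (by rw [card_roots_trinomialPerron hk, hdeg]) (k := N - j) (by omega)
  rw [coeff_trinomialPerron (by omega) (by omega), hdeg, Nat.sub_sub_self (by omega), ← hz] at this
  simpa [leadingCoeff_ne_zero.2 (trinomialPerron_ne_zero hk)] using this.symm

/-- The roots of `X ^ N - X ^ k - 1` approach the unit circle uniformly. -/
theorem eventually_abs_norm_sub_one_lt {k : ℕ} (hk : 0 < k) {ε : ℝ} (hε : 0 < ε) :
    ∀ᶠ N : ℕ in atTop, ∀ z : ℂ, z ^ N = 1 + z ^ k → |‖z‖ - 1| < ε := by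
  wlog hε1 : ε < 1 generalizing ε
  · filter_upwards [this (ε := 1 / 2) (by norm_num) (by norm_num)] with N hN z hz
    linarith [hN z hz]
  -- If |z| ≥ 1 + ε, then |z|^N > 2|z|^k ≥ 1 + |z|^k. If |z| ≤ 1 - ε, then |z|^N < 1 - (1 - ε)^k ≤
  -- |1 + z^k|. Either contradicts the equation.
  have h1 := (tendsto_pow_atTop_atTop_of_one_lt (r := 1 + ε) (by linarith)).eventually_gt_atTop 2
  have h2 := (tendsto_pow_atTop_nhds_zero_of_lt_one (r := 1 - ε) (by linarith)
    (by linarith)).eventually_lt_const (u := 1 - (1 - ε) ^ k)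
    (by linarith [pow_lt_one₀ (by linarith : 0 ≤ 1 - ε) (by linarith) hk.ne'])
  filter_upwards [(tendsto_sub_atTop_nat k).eventually h1, h2, eventually_gt_atTop k]
    with N h1 h2 hN z hz
  have hnorm : ‖z‖ ^ N = ‖1 + z ^ k‖ := by rw [← norm_pow, hz]
  rw [abs_lt]
  constructor
  · by_contra! hlt
    have hz1 : ‖z‖ ≤ 1 - ε := by linarith
    have h3 : ‖z‖ ^ N ≤ (1 - ε) ^ N := pow_le_pow_left₀ (norm_nonneg z) hz1 N
    have h4 : ‖z‖ ^ k ≤ (1 - ε) ^ k := pow_le_pow_left₀ (norm_nonneg z) hz1 k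
    have h5 := norm_sub_le_norm_add (1 : ℂ) (z ^ k)
    rw [norm_one, norm_pow] at h5
    linarith
  · by_contra! hlt
    have hz1 : 1 + ε ≤ ‖z‖ := by linarith
    have h3 : (1 + ε) ^ (N - k) ≤ ‖z‖ ^ (N - k) := pow_le_pow_left₀ (by linarith) hz1 _
    have h4 : 1 ≤ ‖z‖ ^ k := one_le_pow₀ (by linarith)
    have h5 := norm_add_le (1 : ℂ) (z ^ k)
    rw [norm_one, norm_pow, ← hnorm, ← Nat.sub_add_cancel hN.le, pow_add] at h5
    nlinarith

theorem eventually_abs_norm_pow_sub_one_lt {k : ℕ} (hk : 0 < k) (j : ℕ) {ε : ℝ} (hε : 0 < ε) :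
    ∀ᶠ N : ℕ in atTop, ∀ z : ℂ, z ^ N = 1 + z ^ k → |‖z‖ ^ j - 1| < ε := by
  have hc : Tendsto (fun x : ℝ => x ^ j) (𝓝 1) (𝓝 1) := by
    simpa using (continuous_pow (M := ℝ) j).tendsto 1
  obtain ⟨δ, hδ, h⟩ := Metric.tendsto_nhds_nhds.1 hc ε hε
  filter_upwards [eventually_abs_norm_sub_one_lt hk hδ] with N hN z hz
  exact h (hN z hz)

/-- With w = z^k, |z|^(2N) = |1 + w|² = 1 + |w|(2 cos arg w + |w|). -/
theorem one_lt_norm_iff_of_pow_eq {N k : ℕ} (hN : 0 < N) {z : ℂ} (hz : z ^ N = 1 + z ^ k)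
    (h0 : 0 < ‖z‖ ^ k) : 1 < ‖z‖ ↔ -‖z‖ ^ k < 2 * Real.cos (z ^ k).arg := by
  have hsq : ‖1 + z ^ k‖ ^ 2 = 1 + ‖z‖ ^ k * (2 * Real.cos (z ^ k).arg + ‖z‖ ^ k) := by
    have hre := Complex.norm_mul_cos_arg (z ^ k)
    have hn := Complex.sq_norm (z ^ k)
    rw [Complex.normSq_apply] at hn
    rw [norm_pow] at hre hn
    rw [Complex.sq_norm, Complex.normSq_apply]
    simp only [Complex.add_re, Complex.one_re, Complex.add_im, Complex.one_im]
    linear_combination (-2) * hre - hn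
  rw [← one_lt_pow_iff_of_nonneg (norm_nonneg z) hN.ne', ← norm_pow, hz,
    ← one_lt_pow_iff_of_nonneg (norm_nonneg _) two_ne_zero, hsq, lt_add_iff_pos_right,
    mul_pos_iff_of_pos_left h0]
  constructor <;> intro h <;> linarith

/-- Two thirds of the roots of `X ^ N - X ^ k - 1` lie outside the unit circle, asymptotically. -/
theorem tendsto_countP_one_lt_norm_roots_trinomialPerron {k : ℕ} (hk : 0 < k) :
    Tendsto (fun N : ℕ => ((trinomialPerron ℂ N k).roots.countP (1 < ‖·‖) : ℝ) / N) atTop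
      (𝓝 (2 / 3)) := by
  have hex : ∀ N, ∃ z : Fin N → ℂ,
      k < N → Finset.univ.val.map z = (trinomialPerron ℂ N k).roots := by
    intro N
    by_cases h : k < N
    · have hcard := card_roots_trinomialPerron h
      refine ⟨fun i => (trinomialPerron ℂ N k).roots.toList.get (i.cast (by simp [hcard])),
        fun _ => ?_⟩
      rw [Fin.univ_val_map]
      conv_rhs => rw [← Multiset.coe_toList (trinomialPerron ℂ N k).roots]
      congr 1
      refine List.ext_get (by simp [hcard]) fun i h1 h2 => by simp
    · exact ⟨0, fun h' => absurd h' h⟩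
  choose z hz using hex
  have hroot : ∀ N, k < N → ∀ i, z N i ^ N = 1 + z N i ^ k := fun N hN i =>
    pow_eq_of_mem_roots_trinomialPerron (by
      rw [← hz N hN]; exact Multiset.mem_map_of_mem _ (Finset.mem_univ i))
  -- Each exponential differs from z^(km) by | |z|^(km) - 1 |, which is uniformly small, and the sum
  -- of the z^(km) is zero.
  have hmom : ∀ m : ℕ, 0 < m → Tendsto (fun N : ℕ => (N : ℂ)⁻¹ *
      ∑ i, Complex.exp (m * ((z N i ^ k).arg : ℝ) * Complex.I)) atTop (𝓝 0) := by
    intro m hm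
    rw [Metric.tendsto_atTop']
    intro ε hε
    obtain ⟨N₀, hN₀⟩ := eventually_atTop.1
      (eventually_abs_norm_pow_sub_one_lt hk (k * m) (half_pos hε))
    refine ⟨N₀ + k * m + k, fun N hN => ?_⟩
    have hNpos : (0 : ℝ) < N := by exact_mod_cast (by omega : 0 < N)
    have hsum := sum_pow_roots_trinomialPerron (Nat.mul_pos hk hm) (by omega) (z N)
      (hz N (by omega))
    rw [dist_zero_right, ← sub_zero (∑ i, Complex.exp _), ← hsum, ← Finset.sum_sub_distrib,
      norm_mul, norm_inv, Complex.norm_natCast, inv_mul_lt_iff₀ hNpos]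
    have hterm : ∀ i, ‖Complex.exp (m * ((z N i ^ k).arg : ℝ) * Complex.I) - z N i ^ (k * m)‖
        ≤ ε / 2 := by
      intro i
      have h1 := hN₀ N (by omega) (z N i) (hroot N (by omega) i)
      have h2 : z N i ^ (k * m) = (‖z N i‖ ^ (k * m) : ℝ) *
          Complex.exp (m * ((z N i ^ k).arg : ℝ) * Complex.I) := by
        conv_lhs => rw [pow_mul, ← Complex.norm_mul_exp_arg_mul_I (z N i ^ k), mul_pow,
          ← Complex.exp_nat_mul, norm_pow]
        push_cast
        rw [pow_mul, mul_assoc]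
      have h3 : ‖Complex.exp (m * ((z N i ^ k).arg : ℝ) * Complex.I)‖ = 1 := by
        have := Complex.norm_exp_ofReal_mul_I (m * (z N i ^ k).arg)
        push_cast at this
        exact this
      rw [h2, ← one_sub_mul, norm_mul, h3, mul_one, ← Complex.ofReal_one, ← Complex.ofReal_sub,
        Complex.norm_real, Real.norm_eq_abs, abs_sub_comm]
      exact h1.le
    refine (norm_sum_le _ _).trans_lt ((Finset.sum_le_sum fun i _ => hterm i).trans_lt ?_)
    simp only [Finset.sum_const, Finset.card_univ, Fintype.card_fin, nsmul_eq_mul]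
    exact mul_lt_mul_of_pos_left (half_lt_self hε) hNpos
  have hpi := Real.pi_pos
  have hcos : Real.cos (2 * Real.pi / 3) = -1 / 2 := by
    rw [show 2 * Real.pi / 3 = Real.pi - Real.pi / 3 by ring, Real.cos_pi_sub,
      Real.cos_pi_div_three]
    norm_num
  have hmain := tendsto_density_of_equidistributed hmom (β := 2 * Real.pi / 3) (by positivity)
    (by linarith) (A := fun N => {i | 1 < ‖z N i‖}) ?_ ?_
  · rw [show 2 * Real.pi / 3 / Real.pi = 2 / 3 by field_simp] at hmain
    refine hmain.congr' ?_
    filter_upwards [eventually_gt_atTop k] with N hN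
    rw [← hz N hN, Multiset.countP_map]
    rfl
  · intro a ha haβ
    have hlt := Real.cos_lt_cos_of_nonneg_of_le_pi ha (by linarith) haβ
    rw [hcos] at hlt
    -- The 1 in the minimum keeps |z|^k positive; the other term gives -|z|^k < 2 cos a.
    filter_upwards [eventually_gt_atTop k, eventually_abs_norm_pow_sub_one_lt hk k
      (ε := min 1 (1 + 2 * Real.cos a)) (lt_min one_pos (by linarith))] with N hN h i hi
    have hr := abs_lt.1 (h _ (hroot N hN i))
    have h1 := min_le_left 1 (1 + 2 * Real.cos a)
    have h2 := min_le_right 1 (1 + 2 * Real.cos a)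
    simp only [Finset.mem_filter_univ]
    rw [one_lt_norm_iff_of_pow_eq (by omega) (hroot N hN i) (by linarith)]
    linarith
  · intro b hb hbpi
    have hlt := Real.cos_lt_cos_of_nonneg_of_le_pi (by positivity) hbpi hb
    rw [hcos] at hlt
    filter_upwards [eventually_gt_atTop k, eventually_abs_norm_pow_sub_one_lt hk k
      (ε := min 1 (-1 - 2 * Real.cos b)) (lt_min one_pos (by linarith))] with N hN h i hi
    have hr := abs_lt.1 (h _ (hroot N hN i))
    have h1 := min_le_left 1 (-1 - 2 * Real.cos b)
    have h2 := min_le_right 1 (-1 - 2 * Real.cos b)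
    simp only [Finset.mem_filter_univ] at hi
    rw [one_lt_norm_iff_of_pow_eq (by omega) (hroot N hN i) (by linarith)] at hi
    linarith

end Trinomial
-- Existence of smallest Perron numbers.
section SmallestPerron

/-- `X ^ n - X - 1` defines a Perron number of degree `n`. -/
theorem exists_isPerron {n : ℕ} (hn : 2 ≤ n) : ∃ α : ℝ, IsPerron n α := by
  obtain ⟨α, ⟨hα1, hα2⟩, hα⟩ : ∃ α ∈ Set.Icc (1 : ℝ) 2, α ^ n - α - 1 = 0 := by
    have hc : ContinuousOn (fun x : ℝ => x ^ n - x - 1) (Set.Icc 1 2) := by fun_prop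
    refine intermediate_value_Icc (by norm_num) hc ⟨by norm_num, ?_⟩
    have : (2 : ℝ) ^ 2 ≤ 2 ^ n := pow_le_pow_right₀ (by norm_num) hn
    linarith
  have hT : ∀ (R : Type) [CommRing R], trinomialPerron R n 1 = X ^ n - X - 1 := fun R _ => by
    rw [trinomialPerron, pow_one]
  have hmin : minpoly ℚ α = X ^ n - X - 1 :=
    (minpoly.eq_of_irreducible_of_monic (X_pow_sub_X_sub_one_irreducible_rat (by omega))
      (by simpa using hα) (hT ℚ ▸ monic_trinomialPerron (by omega))).symm
  refine ⟨α, ⟨X ^ n - X - 1, hT ℤ ▸ monic_trinomialPerron (by omega), by simpa using hα⟩, ?_, hn,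
    ?_⟩
  · rw [hmin, ← hT ℚ, natDegree_trinomialPerron (by omega)]
  · intro z hz hne
    have hz' : z ^ n = z + 1 := by
      have := (mem_rootSet.1 hz).2
      simp only [hmin, map_sub, map_pow, aeval_X, map_one] at this
      linear_combination this
    -- If |z| ≥ α, then |z|(|z|^(n-1) - 1) ≤ 1 = α(α^(n-1) - 1) forces |z| = α. Equality in the
    -- triangle inequality for z + 1 then gives z = α.
    by_contra! hle
    have hnorm : ‖z‖ ^ n = ‖z + 1‖ := by rw [← norm_pow, hz']
    have htri : ‖z + 1‖ ≤ ‖z‖ + 1 := by simpa using norm_add_le z 1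
    obtain ⟨m, rfl⟩ : ∃ m, n = m + 1 := ⟨n - 1, by omega⟩
    have hpow : α ^ m ≤ ‖z‖ ^ m := pow_le_pow_left₀ (by linarith) hle m
    rw [pow_succ] at hα hnorm
    have hα0 : 1 < α ^ m := by
      by_contra! h
      nlinarith
    have hr : ‖z‖ = α := by nlinarith
    have hsum : ‖z + 1‖ = α + 1 := by rw [← hnorm, hr]; linarith
    have h1 := Complex.sq_norm z
    have h2 := Complex.sq_norm (z + 1)
    rw [hr, Complex.normSq_apply] at h1
    rw [hsum, Complex.normSq_apply] at h2
    simp only [Complex.add_re, Complex.one_re, Complex.add_im, Complex.one_im] at h2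
    have hre : z.re = α := by nlinarith
    rw [hre] at h1
    have him : z.im = 0 := by
      have : z.im * z.im = 0 := by linarith
      simpa using this
    exact hne (Complex.ext (by simpa using hre) (by simpa using him))

theorem IsPerron.pos {n : ℕ} {α : ℝ} (h : IsPerron n α) : 0 < α := by
  classical
  have hint : IsIntegral ℚ α := h.isIntegral.tower_top
  have hcard : 1 < Fintype.card ((minpoly ℚ α).rootSet ℂ) := by
    rw [card_rootSet_eq_natDegree (minpoly.irreducible hint).separable (IsAlgClosed.splits _),
      h.degree_eq]
    exact h.two_le
  have hmem : (α : ℂ) ∈ (minpoly ℚ α).rootSet ℂ := by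
    refine mem_rootSet.2 ⟨minpoly.ne_zero hint, ?_⟩
    rw [← Complex.coe_algebraMap, aeval_algebraMap_apply, minpoly.aeval, map_zero]
  obtain ⟨z, hz⟩ := Fintype.exists_ne_of_one_lt_card hcard ⟨(α : ℂ), hmem⟩
  exact (norm_nonneg _).trans_lt (h.dominant z z.2 fun h' => hz (Subtype.ext h'))

/-- There are finitely many Perron numbers of given degree below a given bound. -/
theorem finite_isPerron_le (n : ℕ) (B : ℝ) : {β : ℝ | IsPerron n β ∧ β ≤ B}.Finite := by
  classical
  -- All conjugates have modulus at most `B`, so this bounds the integer coefficients of the minimal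
  -- polynomial.
  let C := Nat.ceil (max B 1 ^ n * n.choose (n / 2))
  have := bUnion_roots_finite (algebraMap ℤ ℝ) n (Set.finite_Icc (-C : ℤ) C)
  refine this.subset fun β hβ => ?_
  obtain ⟨hP, hB⟩ := hβ
  have hmap := minpoly.isIntegrallyClosed_eq_field_fractions' ℚ hP.isIntegral
  have hdeg : (minpoly ℤ β).natDegree = n := by
    rw [← (minpoly.monic hP.isIntegral).natDegree_map (algebraMap ℤ ℚ), ← hmap, hP.degree_eq]
  simp_rw [Set.mem_iUnion]
  refine ⟨_, ⟨hdeg.le, fun i => ?_⟩,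
    mem_rootSet.2 ⟨minpoly.ne_zero hP.isIntegral, minpoly.aeval ℤ β⟩⟩
  rw [Set.mem_Icc, ← abs_le, ← @Int.cast_le ℝ]
  refine le_trans ?_ (Nat.le_ceil _)
  have hb := coeff_bdd_of_roots_le (B := B) (d := n) (algebraMap ℚ ℂ)
    (minpoly.monic hP.isIntegral.tower_top) (IsAlgClosed.splits _) hP.degree_eq.le
    (fun z hz => ?_) i
  · rw [hmap, coeff_map, coeff_map] at hb
    simpa using hb
  · have hzc : z ∈ conjugates β := by
      rw [conjugates, mem_rootSet']
      exact ⟨(mem_roots'.1 hz).1, by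
        have := (mem_roots'.1 hz).2
        rwa [IsRoot.def, eval_map_algebraMap] at this⟩
    by_cases hzβ : z = (β : ℂ)
    · rwa [hzβ, Complex.norm_real, Real.norm_of_nonneg hP.pos.le]
    · exact (hP.dominant z hzc hzβ).le.trans hB

theorem exists_isSmallestPerron {n : ℕ} (hn : 2 ≤ n) : ∃ α : ℝ, IsSmallestPerron n α := by
  obtain ⟨β, hβ⟩ := exists_isPerron hn
  obtain ⟨α, ⟨hα, hαβ⟩, hmin⟩ := Set.exists_min_image _ id (finite_isPerron_le n β) ⟨β, hβ, le_rfl⟩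
  refine ⟨α, hα, fun γ hγ => ?_⟩
  rcases le_total γ β with h | h
  · exact hmin γ ⟨hγ, h⟩
  · exact hαβ.trans h

end SmallestPerron

/-! ### From counting roots to `nu`. -/

section Count

open Topology

theorem nu_eq_countP {α : ℝ} (hα : IsIntegral ℚ α) :
    nu α = ((minpoly ℚ α).aroots ℂ).countP (1 < ‖·‖) := by
  classical
  have hnd : ((minpoly ℚ α).aroots ℂ).Nodup :=
    nodup_aroots_iff_of_splits (minpoly.ne_zero hα) (IsAlgClosed.splits _) |>.2
      (minpoly.irreducible hα).separable
  rw [nu, conjugates, Multiset.countP_eq_card_filter]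
  have : {z ∈ (minpoly ℚ α).rootSet ℂ | 1 < ‖z‖} =
      (((minpoly ℚ α).aroots ℂ).filter (1 < ‖·‖)).toFinset := by
    ext z
    simp [rootSet]
  rw [this, Set.ncard_coe_finset, Multiset.toFinset_card_of_nodup (hnd.filter _)]

theorem norm_eq_one_of_mem_aroots {z : ℂ} (hz : z ∈ (X ^ 2 - X + 1 : ℚ[X]).aroots ℂ) :
    ‖z‖ = 1 := by
  have h := (mem_aroots'.1 hz).2
  simp only [map_add, map_sub, map_pow, aeval_X, map_one] at h
  -- The cofactor is (z + 1)(z³ - 1) = (z⁶ - 1)/(z² - z + 1).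
  have h6 : z ^ 6 = 1 := by linear_combination (z ^ 4 + z ^ 3 - z - 1) * h
  exact Complex.norm_eq_one_of_pow_eq_one h6 (by norm_num)

theorem nu_eq_countP_roots_of_mul_eq {α : ℝ} (hα : IsIntegral ℚ α) {N k : ℕ} (hk : k < N)
    (h : minpoly ℚ α * (X ^ 2 - X + 1) = trinomialPerron ℚ N k) :
    nu α = (trinomialPerron ℂ N k).roots.countP (1 < ‖·‖) := by
  have hmap : trinomialPerron ℂ N k = (trinomialPerron ℚ N k).map (algebraMap ℚ ℂ) := by
    simp [trinomialPerron]
  have hne : (trinomialPerron ℚ N k).map (algebraMap ℚ ℂ) ≠ 0 := hmap ▸ trinomialPerron_ne_zero hk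
  rw [hmap]
  rw [← h, Polynomial.map_mul] at hne ⊢
  rw [roots_mul hne, Multiset.countP_add, nu_eq_countP hα, left_eq_add, Multiset.countP_eq_zero]
  intro z hz
  exact (norm_eq_one_of_mem_aroots hz).le.not_gt

theorem nu_eq_countP_roots_of_eq {α : ℝ} (hα : IsIntegral ℚ α) {N k : ℕ}
    (h : minpoly ℚ α = trinomialPerron ℚ N k) :
    nu α = (trinomialPerron ℂ N k).roots.countP (1 < ‖·‖) := by
  rw [nu_eq_countP hα, h, aroots]
  simp [trinomialPerron]

/-- The density of roots outside the unit circle is not affected by a bounded change of degree. -/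
theorem tendsto_countP_roots_trinomialPerron_add {k : ℕ} (hk : 0 < k) (d : ℕ) :
    Tendsto (fun n : ℕ => ((trinomialPerron ℂ (n + d) k).roots.countP (1 < ‖·‖) : ℝ) / n) atTop
      (𝓝 (2 / 3)) := by
  have h1 := (tendsto_countP_one_lt_norm_roots_trinomialPerron hk).comp (tendsto_add_atTop_nat d)
  have h2 : Tendsto (fun n : ℕ => 1 + (d : ℝ) / n) atTop (𝓝 (1 + 0)) :=
    tendsto_const_nhds.add (tendsto_const_div_atTop_nhds_zero_nat _)
  have h3 := h1.mul h2
  rw [add_zero, mul_one] at h3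
  refine h3.congr' ?_
  filter_upwards [eventually_gt_atTop 0] with n hn
  have : (n : ℝ) ≠ 0 := by exact_mod_cast hn.ne'
  have : (n : ℝ) + d ≠ 0 := by positivity
  simp only [Function.comp, Nat.cast_add]
  field_simp

theorem tendsto_nu_div_of_lindBoyd (hLB : LindBoydConjecture) {α : ℕ → ℝ}
    (hα : ∀ n : ℕ, 2 < n → IsSmallestPerron n (α n)) :
    Tendsto (fun n : ℕ => (nu (α n) : ℝ) / n) atTop (𝓝 (2 / 3)) := by
  have h1 := tendsto_countP_roots_trinomialPerron_add one_pos 0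
  have h2 := tendsto_countP_roots_trinomialPerron_add two_pos 2
  have h4 := tendsto_countP_roots_trinomialPerron_add four_pos 2
  -- All three trinomial families have limit 2/3, so for large n each ratio lies in the given
  -- neighbourhood, whichever family the residue mod 6 selects.
  rw [tendsto_iff_forall_eventually_mem] at h1 h2 h4 ⊢
  intro s hs
  filter_upwards [h1 s hs, h2 s hs, h4 s hs, eventually_gt_atTop 2] with n h1 h2 h4 hn
  obtain ⟨hA, hB, hC⟩ := hLB n (α n) hn (hα n hn)
  have hint : IsIntegral ℚ (α n) := (hα n hn).1.isIntegral.tower_top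
  by_cases h3 : n % 6 = 3
  · rwa [nu_eq_countP_roots_of_mul_eq hint (by omega) (hB h3)]
  by_cases h5 : n % 6 = 5
  · rwa [nu_eq_countP_roots_of_mul_eq hint (by omega) (hC h5)]
  · rwa [nu_eq_countP_roots_of_eq hint (N := n + 0) (k := 1)
      (by rw [hA h3 h5, trinomialPerron, pow_one, add_zero])]

end Count

theorem mainTheorem3 :
    (∀ n : ℕ, 2 < n → ∃ α : ℝ, IsSmallestPerron n α) ∧
    (LindBoydConjecture →
      ∀ α : ℕ → ℝ, (∀ n : ℕ, 2 < n → IsSmallestPerron n (α n)) →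
        (fun n : ℕ => (nu (α n) : ℝ)) ~[atTop] (fun n : ℕ => (2 / 3 : ℝ) * (n : ℝ))) := by
  refine ⟨fun n hn => exists_isSmallestPerron hn.le, fun hLB α hα => ?_⟩
  refine isEquivalent_of_tendsto_one ?_
  have h := (tendsto_nu_div_of_lindBoyd hLB hα).div_const (2 / 3)
  rw [div_self (by norm_num)] at h
  refine h.congr fun n => ?_
  simp only [Pi.div_apply]
  rw [div_div, mul_comm]
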